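/- Let $F$ be an arbitrary field and consider a quadrilateral tiling of the sphere, i.e. a finite cell decomposition of the sphere in which the closure of every 2-cell is an embedded quadrilateral and whose vertices are coloured black and white so that every edge joins vertices of different colours. Assign to each vertex of the tiling a line in $\mathbb{P}^3(F)$ so that the lines assigned to the endpoints of every edge are skew (have no common point). Assume that for all faces of the tiling but one, the four lines assigned to the vertices of the face lie in a single ruling of a quadric surface. Then the four lines assigned to the vertices of the remaining face also lie in a single ruling of a quadric surface. Here quadric surfaces and their rulings may be degenerate. If the quadric is nonsingular, the ruling containing a line $L_0$ of the quadric consists of $L_0$ and of all lines of the quadric that are skew to $L_0$. If the quadric is a cone with a single singular point $v$, its ruling consists of its lines through $v$. If the quadric is a union of two different planes $P\cup Q$, a ruling of it is the union of the pencil of lines in $P$ through $p$ and the pencil of lines in $Q$ through $r$, where $p\neq r$ are points of the line $P\cap Q$. (If some three of the lines in a ruling are pairwise skew, the quadric is nonsingular.) -/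

import Mathlib

/-- A combinatorial map on a closed oriented surface, on a finite set `D` of darts
(oriented edges). `rev` reverses a dart; `next` sends a dart to the one following it on the
boundary of the face on its left. Gluing a polygon for every cycle of `next`, along `rev`,
gives a closed oriented surface with a cellular decomposition, and every cellular
decomposition (with at least one edge) of such a surface arises in this way. -/
structure SurfaceMap (D : Type*) where
  rev : Equiv.Perm D
  next : Equiv.Perm D
  rev_rev : ∀ d, rev (rev d) = d
  rev_ne : ∀ d, rev d ≠ d

namespace SurfaceMap

variable {D : Type*} (T : SurfaceMap D)

/-- The rotation about the tail: the reverse of the dart that precedes `d` on its face. -/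
def rot : Equiv.Perm D := T.rev * T.next⁻¹

/-- Vertices are the cycles of the rotation. -/
def Vertex : Type _ := Quotient (Equiv.Perm.SameCycle.setoid T.rot)

/-- Edges are the pairs of mutually reverse darts. -/
def Edge : Type _ := Quotient (Equiv.Perm.SameCycle.setoid T.rev)

/-- Faces are the cycles of `next`. -/
def Face : Type _ := Quotient (Equiv.Perm.SameCycle.setoid T.next)

/-- The vertex at which a dart starts. -/
def tail (d : D) : T.Vertex := Quotient.mk (Equiv.Perm.SameCycle.setoid T.rot) d

/-- The vertex at which a dart ends. -/
def head (d : D) : T.Vertex := T.tail (T.rev d)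

/-- The face on the left of a dart. -/
def face (d : D) : T.Face := Quotient.mk (Equiv.Perm.SameCycle.setoid T.next) d

/-- The vertices of a face. -/
def faceVertices (f : T.Face) : Set T.Vertex := {v | ∃ d, T.face d = f ∧ T.tail d = v}

/-- The surface is connected. -/
def IsConnected : Prop :=
  ∀ d e : D, ∃ g ∈ Subgroup.closure ({T.rev, T.next} : Set (Equiv.Perm D)), g d = e

/-- The surface is the sphere: it is connected and `|V| - |E| + |F| = 2`. -/
def IsSphere : Prop :=
  T.IsConnected ∧ (Nat.card T.Vertex : ℤ) - Nat.card T.Edge + Nat.card T.Face = 2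

/-- Every face is an embedded quadrilateral: its boundary walk closes up after four steps and
passes through four different vertices. -/
def FacesAreQuadrilaterals : Prop :=
  ∀ d : D, T.next (T.next (T.next (T.next d))) = d ∧
    Function.Injective
      ![T.tail d, T.tail (T.next d), T.tail (T.next (T.next d)),
        T.tail (T.next (T.next (T.next d)))]

/-- The vertices can be coloured black and white so that every edge joins vertices of
different colours. -/
def IsBicolorable : Prop :=
  ∃ black : T.Vertex → Bool, ∀ d : D, black (T.tail d) ≠ black (T.head d)

/-- A quadrilateral tiling of the sphere. -/
structure IsSphereQuadTiling : Prop where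
  sphere : T.IsSphere
  quad : T.FacesAreQuadrilaterals
  bicolorable : T.IsBicolorable

end SurfaceMap

namespace ProjectiveThreeSpace

variable {F : Type*} [Field F]

/-- The lines of `ℙ³(F)` are the two-dimensional subspaces of `F⁴`. -/
def IsLine (L : Submodule F (Fin 4 → F)) : Prop := Module.finrank F L = 2

/-- Two lines of `ℙ³(F)` are skew if they have no common point. -/
def Skew (L M : Submodule F (Fin 4 → F)) : Prop := Disjoint L M

/-- `L` is a line on the quadric surface `q = 0`. -/
def IsLineOn (q : QuadraticForm F (Fin 4 → F)) (L : Submodule F (Fin 4 → F)) : Prop :=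
  IsLine L ∧ ∀ x ∈ L, q x = 0

/-- `R` is a ruling of the quadric surface `q = 0`. -/
inductive IsRuling (q : QuadraticForm F (Fin 4 → F)) :
    Set (Submodule F (Fin 4 → F)) → Prop
  /-- The quadric is nonsingular. The ruling through a line `L₀` of the quadric consists of
  `L₀` and the lines of the quadric skew to `L₀`. -/
  | nonsingular
      (hq : ∀ x, (∀ y, QuadraticMap.polar q x y = 0) → x = 0)
      (L₀ : Submodule F (Fin 4 → F)) (hL₀ : IsLineOn q L₀) :
      IsRuling q {L | IsLineOn q L ∧ (L = L₀ ∨ Skew L L₀)}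
  /-- The quadric is a cone with `v` as its only singular point; its ruling consists of its
  lines through `v`. -/
  | cone (v : Fin 4 → F) (hv : v ≠ 0)
      (hq : ∀ x, (q x = 0 ∧ ∀ y, QuadraticMap.polar q x y = 0) ↔
        x ∈ Submodule.span F ({v} : Set (Fin 4 → F))) :
      IsRuling q {L | IsLineOn q L ∧ v ∈ L}
  /-- The quadric is the union of two different planes `f = 0` and `g = 0`. A ruling consists
  of the lines of the first plane through a point `p` and the lines of the second plane
  through a point `r`, where `p ≠ r` lie on the line common to the planes. -/
  | planes (f g : Module.Dual F (Fin 4 → F)) (hfg : LinearIndependent F ![f, g])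
      (hq : ∀ x, q x = f x * g x)
      (p r : Fin 4 → F) (hpr : LinearIndependent F ![p, r])
      (hp : f p = 0 ∧ g p = 0) (hr : f r = 0 ∧ g r = 0) :
      IsRuling q {L | IsLine L ∧
        ((L ≤ LinearMap.ker f ∧ p ∈ L) ∨ (L ≤ LinearMap.ker g ∧ r ∈ L))}

/-- The lines in `S` lie in a single ruling of a quadric surface. -/
def LieInSingleRuling (S : Set (Submodule F (Fin 4 → F))) : Prop :=
  ∃ (q : QuadraticForm F (Fin 4 → F)) (R : Set (Submodule F (Fin 4 → F))),
    IsRuling q R ∧ S ⊆ R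

end ProjectiveThreeSpace

/-! ### Rulings force scalar monodromy. -/

namespace ProjectiveThreeSpace

variable {F : Type*} [Field F] {A B C E : Submodule F (Fin 4 → F)}

/-! Let `A`, `B`, `C`, `E` be the lines around a face. Since `B` is complementary to both `A` and
`C`, the isomorphisms `A ≅ F⁴/B ≅ C` carry `A` to `C`; going back through `F⁴/E` gives an
automorphism of `A`, the monodromy of the face. Cyclically skew lines lie in a single ruling exactly
when this monodromy and the one starting at `B` are both scalar
(`LieInSingleRuling.scalarMonodromy`, `lieInSingleRuling_of_scalarMonodromy`).

Attach the plane `L v` to each black vertex and the quotient `F⁴/L v` to each white one. Skewness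
makes every edge an isomorphism, so modulo scalars this is a `PGL₂` local system on the graph of the
tiling, flat around a face exactly when the monodromy at its black vertices is scalar. On a sphere,
flatness around all faces but one yields a global section (`IsSphereQuadTiling.exists_section`): the
edges not crossed by a spanning tree of the dual graph form a spanning tree of the graph, frames can
be chosen along that tree, and the flat faces then align the crossed edges one by one. The section
makes the last face flat as well. Exchanging the colours gives the second monodromy. -/

theorem Skew.symm (h : Skew A B) : Skew B A := Disjoint.symm h

theorem Skew.isCompl (h : Skew A B) (hA : IsLine A) (hB : IsLine B) : IsCompl A B := by
  have hA' : Module.finrank F A = 2 := hA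
  have hB' : Module.finrank F B = 2 := hB
  exact (Submodule.isCompl_iff_disjoint A B (by simp [hA', hB'])).2 h

theorem IsLine.eq_of_le (hA : IsLine A) (hB : IsLine B) (h : A ≤ B) : A = B :=
  Submodule.eq_of_le_of_finrank_eq h (Eq.trans hA (Eq.symm hB))

theorem Skew.eq_zero (h : Skew A B) {x : Fin 4 → F} (hA : x ∈ A) (hB : x ∈ B) : x = 0 :=
  Submodule.disjoint_def.1 h x hA hB

/-- The transport of the vectors of the line `A` to the line `C` along the line `B`, and back
along the line `E`, is a scaling. -/
def ScalarMonodromy (A B C E : Submodule F (Fin 4 → F)) : Prop :=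
  ∃ c : F, ∀ x ∈ A, ∀ x' ∈ A, ∀ y ∈ C, x - y ∈ B → x' - y ∈ E → x' = c • x

/-- An endomorphism for which every vector is an eigenvector is a scaling. Here it is the projection
to `C` along `B` followed by the projection to `A` along `E`. -/
theorem scalarMonodromy_of_collinear (hA : IsLine A) (hB : IsLine B) (hC : IsLine C)
    (hE : IsLine E) (hBC : Skew B C) (hEA : Skew E A)
    (h : ∀ x ∈ A, ∀ x' ∈ A, ∀ y ∈ C, x - y ∈ B → x' - y ∈ E → ¬ LinearIndependent F ![x, x']) :
    ScalarMonodromy A B C E := by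
  have h1 := hBC.symm.isCompl hC hB
  have h2 := hEA.symm.isCompl hA hE
  let f : A →ₗ[F] A := A.projectionOnto E h2 ∘ₗ C.projection B h1 ∘ₗ A.subtype
  obtain ⟨c, hc⟩ := LinearMap.exists_eq_smul_id_of_forall_notLinearIndependent (f := f) (by
    intro v hv
    refine h v v.2 (f v) (f v).2 (C.projection B h1 v) (C.projection_apply_mem h1 v)
      (C.sub_projection_mem h1 v) ?_ ?_
    · have := E.neg_mem (A.sub_projection_mem h2 (C.projection B h1 v))
      rwa [neg_sub] at this
    · have := hv.map' A.subtype (Submodule.ker_subtype A)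
      rwa [show A.subtype ∘ ![v, f v] = ![(v : Fin 4 → F), (f v : Fin 4 → F)] by
        funext i; fin_cases i <;> rfl] at this)
  refine ⟨c, fun x hx x' hx' y hy hxy hxy' => ?_⟩
  have e1 : C.projection B h1 x = y := by
    have := (C.projection_apply_eq_zero_iff h1).2 hxy
    rw [map_sub, C.projection_apply_of_mem_left h1 hy] at this
    exact sub_eq_zero.1 this
  have e2 : A.projection E h2 y = x' := by
    have := (A.projection_apply_eq_zero_iff h2).2 hxy'
    rw [map_sub, A.projection_apply_of_mem_left h2 hx'] at this
    exact (sub_eq_zero.1 this).symm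
  have := congrArg Subtype.val (LinearMap.congr_fun hc ⟨x, hx⟩)
  simp only [f, LinearMap.comp_apply, Submodule.subtype_apply,
    Submodule.coe_projectionOnto_apply, e1, e2] at this
  simpa using this

open QuadraticMap in
theorem IsLineOn.polar_eq_zero {q : QuadraticForm F (Fin 4 → F)} (hA : IsLineOn q A)
    {x y : Fin 4 → F} (hx : x ∈ A) (hy : y ∈ A) : polar q x y = 0 := by
  rw [polar, hA.2 _ (A.add_mem hx hy), hA.2 _ hx, hA.2 _ hy]; simp

open QuadraticMap in
/-- A line on a nonsingular quadric is its own polar. -/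
theorem IsLineOn.mem_of_polar_eq_zero {q : QuadraticForm F (Fin 4 → F)}
    (hq : ∀ x, (∀ y, polar q x y = 0) → x = 0) (hA : IsLineOn q A) {y : Fin 4 → F}
    (hy : ∀ x ∈ A, polar q x y = 0) : y ∈ A := by
  have hnd : q.polarBilin.Nondegenerate :=
    ⟨hq, fun y h => hq y fun x => by rw [polar_comm]; exact h x⟩
  let b : LinearMap.BilinForm F (Fin 4 → F) := q.polarBilin
  have hfin := LinearMap.BilinForm.finrank_orthogonal (B := b) hnd A
  have hA2 : Module.finrank F A = 2 := hA.1
  have : A = b.orthogonal A := by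
    refine Submodule.eq_of_le_of_finrank_eq (fun x hx z hz => hA.polar_eq_zero hz hx) ?_
    rw [hfin, hA2]; simp
  rw [this]
  exact fun x hx => hy x hx

open QuadraticMap in
-- If `x ∈ A` and `y ∈ C` differ by a vector of a line on the quadric, then `q (x - y) = 0` makes
-- them orthogonal for the polar form. Each line is its own orthogonal complement, which leaves too
-- little room for a non-scalar monodromy.
theorem scalarMonodromy_of_nonsingular {q : QuadraticForm F (Fin 4 → F)}
    (hq : ∀ x, (∀ y, polar q x y = 0) → x = 0) (hA : IsLineOn q A) (hB : IsLineOn q B)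
    (hC : IsLineOn q C) (hE : IsLineOn q E) (hAB : Skew A B) (hBC : Skew B C) (hEA : Skew E A) :
    ScalarMonodromy A B C E := by
  have hpol : ∀ {M}, IsLineOn q M → ∀ x ∈ A, ∀ y ∈ C, x - y ∈ M → polar q x y = 0 := by
    intro M hM x hx y hy hxy
    have h := hM.2 _ hxy
    rw [sub_eq_add_neg, QuadraticMap.map_add q, QuadraticMap.map_neg, hA.2 _ hx, hC.2 _ hy,
      polar_neg_right] at h
    simpa using h
  by_cases hAC : Skew A C
  · refine scalarMonodromy_of_collinear hA.1 hB.1 hC.1 hE.1 hBC hEA ?_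
    -- Independent `x`, `x'` would span `A`, so `y`, orthogonal to both, would lie in `A ∩ C = 0`.
    intro x hx x' hx' y hy hxy hxy' hli
    have h1 := hpol hB x hx y hy hxy
    have h2 := hpol hE x' hx' y hy hxy'
    have hspan : Submodule.span F (Set.range ![x, x']) = A := by
      refine Submodule.eq_of_le_of_finrank_eq ?_ ?_
      · rw [Submodule.span_le]
        rintro _ ⟨i, rfl⟩
        fin_cases i
        exacts [hx, hx']
      · rw [finrank_span_eq_card hli]
        exact (Eq.symm hA.1)
    have hyA : y ∈ A := by
      refine hA.mem_of_polar_eq_zero hq fun z hz => ?_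
      rw [← hspan] at hz
      induction hz using Submodule.span_induction with
      | mem z hz =>
        obtain ⟨i, rfl⟩ := hz
        fin_cases i
        exacts [h1, h2]
      | zero => simp
      | add a b _ _ ha hb => rw [polar_add_left, ha, hb, add_zero]
      | smul c a _ ha => rw [polar_smul_left, ha, smul_zero]
    have hy0 := hAC.eq_zero hyA hy
    subst hy0
    exact hli.ne_zero 0 (hAB.eq_zero hx (by simpa using hxy))
  -- Otherwise take `x ∈ A` outside `C`, with transport `y`. Then `x` is orthogonal to `y` and to
  -- the common point `p`, which span `C`, so `x ∈ C`.
  · have hAC' : A = C := by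
      rw [Skew, Submodule.disjoint_def] at hAC
      push Not at hAC
      obtain ⟨p, hpA, hpC, hp⟩ := hAC
      by_contra hne
      obtain ⟨x, hxA, hxC⟩ := SetLike.not_le_iff_exists.1 fun h => hne (hA.1.eq_of_le hC.1 h)
      have h1 := hBC.symm.isCompl hC.1 hB.1
      set y := C.projection B h1 x
      have hy : y ∈ C := C.projection_apply_mem h1 x
      have hxy : x - y ∈ B := C.sub_projection_mem h1 x
      have hpy := hpol hB x hxA y hy hxy
      by_cases hyp : y ∈ A
      · have := hAB.eq_zero (A.sub_mem hxA hyp) hxy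
        exact hxC (sub_eq_zero.1 this ▸ hy)
      have hli : LinearIndependent F ![p, y] := by
        rw [LinearIndependent.pair_iff' hp]
        intro a h
        exact hyp (h ▸ A.smul_mem a hpA)
      have hspan : Submodule.span F (Set.range ![p, y]) = C := by
        refine Submodule.eq_of_le_of_finrank_eq ?_ ?_
        · rw [Submodule.span_le]
          rintro _ ⟨i, rfl⟩
          fin_cases i
          exacts [hpC, hy]
        · rw [finrank_span_eq_card hli]
          exact (Eq.symm hC.1)
      refine hxC (hC.mem_of_polar_eq_zero hq fun z hz => ?_)
      rw [← hspan] at hz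
      induction hz using Submodule.span_induction with
      | mem z hz =>
        obtain ⟨i, rfl⟩ := hz
        fin_cases i
        exacts [hA.polar_eq_zero hpA hxA, (polar_comm _ _ _).trans hpy]
      | zero => simp
      | add a b _ _ ha hb => rw [polar_add_left, ha, hb, add_zero]
      | smul c a _ ha => rw [polar_smul_left, ha, smul_zero]
    subst hAC'
    refine ⟨1, fun x hx x' hx' y hy hxy hxy' => ?_⟩
    have h1 := sub_eq_zero.1 (hAB.eq_zero (A.sub_mem hx hy) hxy)
    have h2 := sub_eq_zero.1 (hEA.eq_zero hxy' (A.sub_mem hx' hy))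
    rw [h1, h2, one_smul]

/-- The plane `f = 0` contains `A` and `C` but not `B`, so it meets `B` only in the point `r`. Hence
`x - y` is a multiple of `r`, which also lies in `E`, and the monodromy is the identity. -/
theorem scalarMonodromy_of_planes {f : Module.Dual F (Fin 4 → F)} {r : Fin 4 → F}
    (hA : IsLine A) (hB : IsLine B) (hr : r ≠ 0) (hfr : f r = 0)
    (hAB : Skew A B) (hEA : Skew E A) (hAf : A ≤ LinearMap.ker f)
    (hCf : C ≤ LinearMap.ker f) (hrB : r ∈ B) (hrE : r ∈ E) (hf : f ≠ 0) :
    ScalarMonodromy A B C E := by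
  have key : ∀ b ∈ B, f b = 0 → ∃ c : F, c • r = b := by
    intro b hb hfb
    by_contra! hcon
    have hli : LinearIndependent F ![r, b] := (LinearIndependent.pair_iff' hr).2 hcon
    have hspan : Submodule.span F (Set.range ![r, b]) = B := by
      refine Submodule.eq_of_le_of_finrank_eq ?_ ?_
      · rw [Submodule.span_le]
        rintro _ ⟨i, rfl⟩
        fin_cases i
        exacts [hrB, hb]
      · rw [finrank_span_eq_card hli]
        exact (Eq.symm hB)
    have hBf : B ≤ LinearMap.ker f := by
      rw [← hspan, Submodule.span_le]
      rintro _ ⟨i, rfl⟩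
      fin_cases i
      exacts [hfr, hfb]
    have htop := sup_le hAf hBf
    rw [(hAB.isCompl hA hB).sup_eq_top, top_le_iff, LinearMap.ker_eq_top] at htop
    exact hf htop
  refine ⟨1, fun x hx x' hx' y hy hxy hxy' => ?_⟩
  obtain ⟨c, hc⟩ := key _ hxy (by
    rw [map_sub, show f x = 0 from hAf hx, show f y = 0 from hCf hy, sub_zero])
  have h1 : x - y ∈ E := hc ▸ E.smul_mem c hrE
  have h2 : x' - x ∈ E := by simpa using E.sub_mem hxy' h1
  rw [one_smul]
  exact sub_eq_zero.1 (hEA.eq_zero h2 (A.sub_mem hx' hx))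

/-- Four cyclically skew lines in a single ruling have scalar monodromy. -/
theorem LieInSingleRuling.scalarMonodromy {S : Set (Submodule F (Fin 4 → F))}
    (h : LieInSingleRuling S) (hA : A ∈ S) (hB : B ∈ S) (hC : C ∈ S) (hE : E ∈ S)
    (hAB : Skew A B) (hBC : Skew B C) (hEA : Skew E A) :
    ScalarMonodromy A B C E := by
  obtain ⟨q, R, hR, hS⟩ := h
  have hA := hS hA
  have hB := hS hB
  have hC := hS hC
  have hE := hS hE
  cases hR with
  | nonsingular hq L₀ hL₀ =>
    exact scalarMonodromy_of_nonsingular hq hA.1 hB.1 hC.1 hE.1 hAB hBC hEA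
  | cone v hv hq => exact absurd (hAB.eq_zero hA.2 hB.2) hv
  | planes f g hfg hq p r hpr hp hr =>
    have hp0 : p ≠ 0 := hpr.ne_zero 0
    have hr0 : r ≠ 0 := hpr.ne_zero 1
    have hf0 : f ≠ 0 := hfg.ne_zero 0
    have hg0 : g ≠ 0 := hfg.ne_zero 1
    -- Skew neighbours cannot belong to the same pencil, so the lines alternate between the two
    -- pencils.
    obtain ⟨lA, ⟨hAf, hpA⟩ | ⟨hAg, hrA⟩⟩ := hA
    · obtain ⟨hBg, hrB⟩ := hB.2.resolve_left fun h => hp0 (hAB.eq_zero hpA h.2)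
      obtain ⟨hEg, hrE⟩ := hE.2.resolve_left fun h => hp0 (hEA.eq_zero h.2 hpA)
      obtain ⟨hCf, hpC⟩ := hC.2.resolve_right fun h => hr0 (hBC.eq_zero hrB h.2)
      exact scalarMonodromy_of_planes lA hB.1 hr0 hr.1 hAB hEA hAf hCf hrB hrE hf0
    · obtain ⟨hBf, hpB⟩ := hB.2.resolve_right fun h => hr0 (hAB.eq_zero hrA h.2)
      obtain ⟨hEf, hpE⟩ := hE.2.resolve_right fun h => hr0 (hEA.eq_zero h.2 hrA)
      obtain ⟨hCg, hrC⟩ := hC.2.resolve_left fun h => hp0 (hBC.eq_zero hpB h.2)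
      exact scalarMonodromy_of_planes lA hB.1 hp0 hp.2 hAB hEA hAg hCg hpB hpE hg0

end ProjectiveThreeSpace

/-! ### From scalar monodromy back to a ruling. -/

namespace ProjectiveThreeSpace

variable {F : Type*} [Field F] {A B C E : Submodule F (Fin 4 → F)}

/-- Cyclically skew lines with scalar monodromy, two opposite ones being skew, lie in a single
ruling of a nonsingular quadric. -/
theorem ScalarMonodromy.lieInSingleRuling_of_skew (hA : IsLine A) (hB : IsLine B)
    (hC : IsLine C) (hE : IsLine E) (hAB : Skew A B) (hBC : Skew B C)
    (hEA : Skew E A) (h : ScalarMonodromy A B C E) (hAC : Skew A C) :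
    LieInSingleRuling {A, B, C, E} := by
  obtain ⟨c, hc⟩ := h
  have hcAC := hAC.isCompl hA hC
  let s := A.projectionOnto C hcAC
  let e : A ≃ₗ[F] (Fin 2 → F) := LinearEquiv.ofFinrankEq _ _ (by rw [hA]; simp)
  -- coordinates along `A`, and along `C` transported to `A`
  let g : C →ₗ[F] A := A.projectionOnto B (hAB.isCompl hA hB) ∘ₗ C.subtype
  have hg0 : ∀ y : C, g y = 0 → y = 0 := by
    intro y hy
    have : (y : Fin 4 → F) ∈ B := (Submodule.projectionOnto_apply_eq_zero_iff _).1 hy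
    exact Subtype.ext (hBC.eq_zero this y.2)
  have hgs : Function.Surjective g := by
    refine (LinearMap.injective_iff_surjective_of_finrank_eq_finrank
      (Eq.trans hC (Eq.symm hA))).1 ?_
    exact (injective_iff_map_eq_zero g).2 hg0
  let t : (Fin 4 → F) →ₗ[F] A := g ∘ₗ C.projectionOnto A hcAC.symm
  let sc (i : Fin 2) : (Fin 4 → F) →ₗ[F] F := LinearMap.proj i ∘ₗ e.toLinearMap ∘ₗ s
  let tc (i : Fin 2) : (Fin 4 → F) →ₗ[F] F := LinearMap.proj i ∘ₗ e.toLinearMap ∘ₗ t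
  -- The determinant of the coordinate vectors of `s x` and `t x`: it vanishes when they are
  -- proportional. The lines `A`, `C`, `B`, `E` are `t = 0`, `s = 0`, `s = -t` and `s = -c t`; the
  -- signs come from writing `x = a - y`.
  let q : QuadraticForm F (Fin 4 → F) :=
    QuadraticMap.linMulLin (sc 0) (tc 1) - QuadraticMap.linMulLin (sc 1) (tc 0)
  have hqv : ∀ x, q x = sc 0 x * tc 1 x - sc 1 x * tc 0 x := fun x => by
    simp [q]
  have hpol : ∀ x y, QuadraticMap.polar q x y =
      sc 0 x * tc 1 y + sc 0 y * tc 1 x - sc 1 x * tc 0 y - sc 1 y * tc 0 x := fun x y => by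
    rw [QuadraticMap.polar, hqv, hqv, hqv]
    simp only [map_add]
    ring
  have hsA : ∀ x (hx : x ∈ A), s x = ⟨x, hx⟩ := fun x hx =>
    Submodule.projectionOnto_apply_left hcAC ⟨x, hx⟩
  have hsC : ∀ x ∈ C, s x = 0 := fun x hx =>
    (Submodule.projectionOnto_apply_eq_zero_iff hcAC).2 hx
  have htA : ∀ x ∈ A, t x = 0 := fun x hx => by
    simp only [t, LinearMap.comp_apply]
    rw [(Submodule.projectionOnto_apply_eq_zero_iff hcAC.symm).2 hx, map_zero]
  have htC : ∀ x (hx : x ∈ C), t x = g ⟨x, hx⟩ := fun x hx => by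
    simp only [t, LinearMap.comp_apply]
    rw [Submodule.projectionOnto_apply_left hcAC.symm ⟨x, hx⟩]
  have hst : ∀ x, s x = 0 → t x = 0 → x = 0 := by
    intro x hs ht
    have h1 : x ∈ C := (Submodule.projectionOnto_apply_eq_zero_iff hcAC).1 hs
    rw [htC x h1] at ht
    exact congrArg Subtype.val (hg0 _ ht)
  have hs' : ∀ u : A, ∃ y, s y = u ∧ t y = 0 := fun u => ⟨u, hsA u u.2, htA u u.2⟩
  have ht' : ∀ u : A, ∃ y, s y = 0 ∧ t y = u := fun u => by
    obtain ⟨y, rfl⟩ := hgs u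
    exact ⟨y, hsC y y.2, htC y y.2⟩
  have hns : ∀ x, (∀ y, QuadraticMap.polar q x y = 0) → x = 0 := by
    intro x hx
    have key : ∀ u : A, (∀ w : Fin 2 → F, e u 0 * w 1 - e u 1 * w 0 = 0) → u = 0 := by
      intro u hu
      have h0 := hu ![0, 1]
      have h1 := hu ![1, 0]
      simp at h0 h1
      apply e.injective
      rw [map_zero]
      ext i
      fin_cases i
      exacts [h0, h1]
    refine hst x (key _ fun w => ?_) (key _ fun w => ?_)
    · obtain ⟨y, hy1, hy2⟩ := ht' (e.symm w)
      have := hx y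
      rw [hpol] at this
      simp only [sc, tc, LinearMap.comp_apply, hy1, hy2, LinearMap.proj_apply,
        LinearEquiv.coe_coe, LinearEquiv.apply_symm_apply, map_zero] at this
      linear_combination this
    · obtain ⟨y, hy1, hy2⟩ := hs' (e.symm w)
      have := hx y
      rw [hpol] at this
      simp only [sc, tc, LinearMap.comp_apply, hy1, hy2, LinearMap.proj_apply,
        LinearEquiv.coe_coe, LinearEquiv.apply_symm_apply, map_zero] at this
      linear_combination -this
  have hq0 : ∀ x (k : F), s x = k • t x → q x = 0 := by
    intro x k hk
    rw [hqv]
    simp only [sc, tc, LinearMap.comp_apply, hk, LinearMap.proj_apply, LinearEquiv.coe_coe,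
      map_smul, smul_eq_mul]
    ring
  have hgB : ∀ y : C, (g y : Fin 4 → F) - y ∈ B := by
    intro y
    have := B.neg_mem (A.sub_projection_mem (hAB.isCompl hA hB) y)
    rwa [neg_sub] at this
  have hdecomp : ∀ x, ∃ a, ∃ ha : a ∈ A, ∃ y, ∃ hy : y ∈ C, x = a - y ∧ s x = ⟨a, ha⟩ ∧
      t x = -g ⟨y, hy⟩ := by
    intro x
    have hx : x ∈ A ⊔ C := hcAC.sup_eq_top ▸ Submodule.mem_top
    obtain ⟨a, ha, y, hy, rfl⟩ := Submodule.mem_sup.1 hx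
    refine ⟨a, ha, -y, C.neg_mem hy, by abel, ?_, ?_⟩
    · rw [map_add, hsA a ha, hsC y hy, add_zero]
    · rw [map_add, htA a ha, htC y hy, zero_add, ← map_neg]
      congr 1
      ext; simp
  have onB : IsLineOn q B := by
    refine ⟨hB, fun x hx => ?_⟩
    obtain ⟨a, ha, y, hy, rfl, h1, h2⟩ := hdecomp x
    refine hq0 _ (-1) ?_
    rw [h1, h2]
    refine Subtype.ext ?_
    change a = (-1 : F) • -(g ⟨y, hy⟩ : Fin 4 → F)
    rw [neg_smul, smul_neg, neg_neg, one_smul]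
    have h3 := B.sub_mem hx (hgB ⟨y, hy⟩)
    have h4 := hAB.eq_zero (x := a - g ⟨y, hy⟩) (A.sub_mem ha (g ⟨y, hy⟩).2)
      (by simpa using h3)
    exact sub_eq_zero.1 h4
  have onE : IsLineOn q E := by
    refine ⟨hE, fun x hx => ?_⟩
    obtain ⟨a, ha, y, hy, rfl, h1, h2⟩ := hdecomp x
    refine hq0 _ (-c) ?_
    rw [h1, h2]
    refine Subtype.ext ?_
    change a = (-c) • -(g ⟨y, hy⟩ : Fin 4 → F)
    rw [neg_smul, smul_neg, neg_neg]
    exact hc _ (g ⟨y, hy⟩).2 a ha y hy (hgB ⟨y, hy⟩) hx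
  have onA : IsLineOn q A := by
    refine ⟨hA, fun x hx => ?_⟩
    rw [hqv]
    simp [tc, htA x hx]
  have onC : IsLineOn q C := ⟨hC, fun x hx => hq0 x 0 (by rw [hsC x hx, zero_smul])⟩
  refine ⟨q, _, IsRuling.nonsingular hns A onA, ?_⟩
  rintro M (rfl | rfl | rfl | rfl)
  exacts [⟨onA, .inl rfl⟩, ⟨onB, .inr hAB.symm⟩, ⟨onC, .inr hAC.symm⟩, ⟨onE, .inr hEA⟩]

theorem not_skew_iff : ¬ Skew A B ↔ ∃ x ∈ A, x ∈ B ∧ x ≠ 0 := by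
  rw [Skew, Submodule.disjoint_def]
  push Not
  rfl

/-- A common point of `A` and `C` is fixed by the monodromy, so the scalar is `1`. For `x ∈ A`
outside `C` with transport `y`, the vector `x - y` then lies in both `B` and `E`. -/
theorem ScalarMonodromy.exists_mem_sup (hA : IsLine A) (hB : IsLine B)
    (hC : IsLine C) (hE : IsLine E) (hBC : Skew B C) (hEA : Skew E A)
    (h : ScalarMonodromy A B C E) (hAC : ¬ Skew A C) (hne : A ≠ C) :
    ∃ r ∈ B, r ∈ E ∧ r ∈ A ⊔ C ∧ r ≠ 0 := by
  obtain ⟨c, hc⟩ := h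
  obtain ⟨p, hpA, hpC, hp⟩ := not_skew_iff.1 hAC
  have hc1 : (1 - c) • p = 0 := by
    have := hc p hpA p hpA p hpC (by simp) (by simp)
    rw [sub_smul, one_smul, ← this, sub_self]
  have hc1 : c = 1 := (sub_eq_zero.1 ((smul_eq_zero.1 hc1).resolve_right hp)).symm
  subst hc1
  obtain ⟨x, hxA, hxC⟩ := SetLike.not_le_iff_exists.1 fun h => hne (hA.eq_of_le hC h)
  have h1 := hBC.symm.isCompl hC hB
  have h2 := hEA.symm.isCompl hA hE
  set y := C.projection B h1 x
  have hy : y ∈ C := C.projection_apply_mem h1 x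
  have hxy : x - y ∈ B := C.sub_projection_mem h1 x
  have hx' : A.projection E h2 y - y ∈ E := by
    have := E.neg_mem (A.sub_projection_mem h2 y)
    rwa [neg_sub] at this
  have h3 := hc x hxA _ (A.projection_apply_mem h2 y) y hy hxy hx'
  rw [h3, one_smul] at hx'
  refine ⟨x - y, hxy, hx', ?_, fun h0 => hxC (sub_eq_zero.1 h0 ▸ hy)⟩
  exact Submodule.sub_mem _ (Submodule.mem_sup_left hxA) (Submodule.mem_sup_right hy)

/-- If `A ≠ C`, the common point `p` bounds the dimension of `A ⊔ C` by `3`. If `A = C`, there is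
still room for an arbitrary `r`. -/
theorem exists_plane (hA : IsLine A) (hC : IsLine C) {p r : Fin 4 → F} (hp : p ≠ 0)
    (hpA : p ∈ A) (hpC : p ∈ C) (hr : A ≠ C → r ∈ A ⊔ C) :
    ∃ f : Module.Dual F (Fin 4 → F), f ≠ 0 ∧ A ≤ LinearMap.ker f ∧ C ≤ LinearMap.ker f ∧
      f r = 0 := by
  have hA2 : Module.finrank F A = 2 := hA
  have hC2 : Module.finrank F C = 2 := hC
  have hlt : A ⊔ C ⊔ Submodule.span F {r} < ⊤ := by
    refine lt_top_iff_ne_top.2 fun htop => ?_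
    have h4 : Module.finrank F (A ⊔ C ⊔ Submodule.span F {r} : Submodule F (Fin 4 → F)) = 4 := by
      rw [htop, finrank_top]; simp
    by_cases hAC : A = C
    · subst hAC
      rw [sup_idem] at h4
      have h1 := Submodule.finrank_add_le_finrank_add_finrank A (Submodule.span F {r})
      have h2 := finrank_span_le_card (R := F) ({r} : Set (Fin 4 → F))
      simp at h2
      omega
    · rw [sup_eq_left.2 ((Submodule.span_singleton_le_iff_mem _ _).2 (hr hAC))] at h4
      have h1 := Submodule.finrank_sup_add_finrank_inf_eq A C
      have h2 : 0 < Module.finrank F (A ⊓ C : Submodule F (Fin 4 → F)) := by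
        refine Module.finrank_pos_iff_exists_ne_zero.2 ⟨⟨p, hpA, hpC⟩, fun h => hp ?_⟩
        exact congrArg Subtype.val h
      omega
  obtain ⟨f, hf, hle⟩ := Submodule.exists_le_ker_of_lt_top _ hlt
  exact ⟨f, hf, (le_sup_left.trans le_sup_left).trans hle,
    (le_sup_right.trans le_sup_left).trans hle,
    hle (Submodule.mem_sup_right (Submodule.mem_span_singleton_self r))⟩

/-- Four cyclically skew lines whose two monodromies are scalar lie in a single ruling. -/
theorem lieInSingleRuling_of_scalarMonodromy (hA : IsLine A) (hB : IsLine B)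
    (hC : IsLine C) (hE : IsLine E) (hAB : Skew A B) (hBC : Skew B C) (hCE : Skew C E)
    (hEA : Skew E A) (h₁ : ScalarMonodromy A B C E) (h₂ : ScalarMonodromy B C E A) :
    LieInSingleRuling {A, B, C, E} := by
  by_cases hAC : Skew A C
  · exact h₁.lieInSingleRuling_of_skew hA hB hC hE hAB hBC hEA hAC
  by_cases hBE : Skew B E
  · have := h₂.lieInSingleRuling_of_skew hB hC hE hA hBC hCE hAB hBE
    convert this using 1
    ext M
    simp only [Set.mem_insert_iff, Set.mem_singleton_iff]
    tauto
  -- Both opposite pairs now meet, so the quadric is a pair of planes: one contains `A`, `C` and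
  -- `r`, the other `B`, `E` and `p`.
  obtain ⟨r, hrB, hrE, hr, hr0⟩ : ∃ r ∈ B, r ∈ E ∧ (A ≠ C → r ∈ A ⊔ C) ∧ r ≠ 0 := by
    by_cases hne : A = C
    · obtain ⟨r, h1, h2, h3⟩ := not_skew_iff.1 hBE
      exact ⟨r, h1, h2, fun h => absurd hne h, h3⟩
    · obtain ⟨r, h1, h2, h3, h4⟩ := h₁.exists_mem_sup hA hB hC hE hBC hEA hAC hne
      exact ⟨r, h1, h2, fun _ => h3, h4⟩
  obtain ⟨p, hpC, hpA, hp, hp0⟩ : ∃ p ∈ C, p ∈ A ∧ (B ≠ E → p ∈ B ⊔ E) ∧ p ≠ 0 := by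
    by_cases hne : B = E
    · obtain ⟨p, h1, h2, h3⟩ := not_skew_iff.1 hAC
      exact ⟨p, h2, h1, fun h => absurd hne h, h3⟩
    · obtain ⟨p, h1, h2, h3, h4⟩ := h₂.exists_mem_sup hB hC hE hA hCE hAB hBE hne
      exact ⟨p, h1, h2, fun _ => h3, h4⟩
  obtain ⟨f, hf, hAf, hCf, hfr⟩ := exists_plane hA hC hp0 hpA hpC hr
  obtain ⟨g, hg, hBg, hEg, hgp⟩ := exists_plane hB hE hr0 hrB hrE hp
  have hfg : LinearIndependent F ![f, g] := by
    rw [LinearIndependent.pair_iff' hf]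
    rintro a rfl
    have htop : A ⊔ B ≤ LinearMap.ker (a • f) :=
      sup_le (fun x hx => by
        have : f x = 0 := hAf hx
        simp [this]) hBg
    rw [(hAB.isCompl hA hB).sup_eq_top, top_le_iff, LinearMap.ker_eq_top] at htop
    exact hg htop
  have hpr : LinearIndependent F ![p, r] := by
    rw [LinearIndependent.pair_iff' hp0]
    rintro a rfl
    exact hr0 (hAB.eq_zero (A.smul_mem a hpA) hrB)
  refine ⟨QuadraticMap.linMulLin f g, _, IsRuling.planes f g hfg (fun x => rfl) p r hpr
    ⟨hAf hpA, hgp⟩ ⟨hfr, hBg hrB⟩, ?_⟩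
  rintro M (rfl | rfl | rfl | rfl)
  exacts [⟨hA, .inl ⟨hAf, hpA⟩⟩, ⟨hB, .inr ⟨hBg, hrB⟩⟩, ⟨hC, .inl ⟨hCf, hpC⟩⟩,
    ⟨hE, .inr ⟨hEg, hrE⟩⟩]

/-! ### Frames and their alignment along edges. -/

/-- `H` parametrizes the line `A`. -/
def FrameOn (A : Submodule F (Fin 4 → F)) (H : (Fin 2 → F) →ₗ[F] (Fin 4 → F)) : Prop :=
  Function.Injective H ∧ LinearMap.range H = A

/-- `H` parametrizes the quotient by the line `B`. -/
def FrameMod (B : Submodule F (Fin 4 → F)) (H : (Fin 2 → F) →ₗ[F] (Fin 4 → F)) : Prop :=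
  ∀ z, H z ∈ B → z = 0

/-- The parametrizations agree modulo `B` up to a nonzero scalar. -/
def Aligned (B : Submodule F (Fin 4 → F)) (H G : (Fin 2 → F) →ₗ[F] (Fin 4 → F)) : Prop :=
  ∃ c : F, c ≠ 0 ∧ ∀ z, H z - c • G z ∈ B

theorem FrameOn.mem {H : (Fin 2 → F) →ₗ[F] (Fin 4 → F)} (h : FrameOn A H) (z : Fin 2 → F) :
    H z ∈ A := h.2 ▸ LinearMap.mem_range_self H z

theorem IsLine.exists_frameOn (hA : IsLine A) : ∃ H, FrameOn A H := by
  let e : (Fin 2 → F) ≃ₗ[F] A := LinearEquiv.ofFinrankEq _ _ (by rw [hA]; simp)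
  refine ⟨A.subtype ∘ₗ e.toLinearMap, A.injective_subtype.comp e.injective, ?_⟩
  rw [LinearMap.range_comp, LinearEquiv.range, Submodule.map_top, Submodule.range_subtype]

theorem FrameOn.frameMod {H : (Fin 2 → F) →ₗ[F] (Fin 4 → F)} (h : FrameOn A H)
    (hAB : Skew A B) : FrameMod B H := fun z hz =>
  h.1 (by rw [hAB.eq_zero (h.mem z) hz, map_zero])

theorem FrameMod.exists_frameOn {G : (Fin 2 → F) →ₗ[F] (Fin 4 → F)} (h : FrameMod B G)
    (hA : IsLine A) (hB : IsLine B) (hAB : Skew A B) : ∃ H, FrameOn A H ∧ Aligned B H G := by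
  have hc := hAB.isCompl hA hB
  have hinj : Function.Injective (A.projection B hc ∘ₗ G) := by
    refine (injective_iff_map_eq_zero _).2 fun z hz => h z ?_
    exact (Submodule.projection_apply_eq_zero_iff hc).1 hz
  refine ⟨A.projection B hc ∘ₗ G, ⟨hinj, ?_⟩, 1, one_ne_zero, fun z => ?_⟩
  · refine Submodule.eq_of_le_of_finrank_eq ?_ ?_
    · rintro _ ⟨z, rfl⟩
      exact A.projection_apply_mem hc _
    · rw [LinearMap.finrank_range_of_inj hinj, hA]
      simp
  · have := B.neg_mem (A.sub_projection_mem hc (G z))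
    rw [neg_sub] at this
    simpa using this

/-- Scalar monodromy closes up the alignment around a quadrilateral. -/
theorem ScalarMonodromy.aligned {HA HB HC HE : (Fin 2 → F) →ₗ[F] (Fin 4 → F)}
    (h : ScalarMonodromy A B C E) (hA : IsLine A) (hB : IsLine B) (hAB : Skew A B)
    (fA : FrameOn A HA) (fC : FrameOn C HC) (hCB : Aligned B HC HB) (hCE : Aligned E HC HE)
    (hAE : Aligned E HA HE) : Aligned B HA HB := by
  obtain ⟨l, hl⟩ := h
  obtain ⟨c₁, hc₁, h₁⟩ := hCB
  obtain ⟨c₂, hc₂, h₂⟩ := hCE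
  obtain ⟨c₃, hc₃, h₃⟩ := hAE
  have hc := hAB.isCompl hA hB
  -- Here `x` is the transport of `HC z` to `A` along `B`, and `(c₂ / c₃) • HA z` its transport
  -- along `E`.
  have key : ∀ z, ∃ x ∈ A, x - HC z ∈ B ∧ (c₂ / c₃) • HA z = l • x := by
    intro z
    have hx : A.projection B hc (HC z) - HC z ∈ B := by
      have := B.neg_mem (A.sub_projection_mem hc (HC z))
      rwa [neg_sub] at this
    refine ⟨_, A.projection_apply_mem hc (HC z), hx, ?_⟩
    refine hl _ (A.projection_apply_mem hc _) _ (A.smul_mem _ (fA.mem z)) _ (fC.mem z) hx ?_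
    have := E.sub_mem (E.smul_mem (c₂ / c₃) (h₃ z)) (h₂ z)
    rw [smul_sub, smul_smul, div_mul_cancel₀ _ hc₃] at this
    simpa using this
  have hl0 : l ≠ 0 := by
    rintro rfl
    obtain ⟨x, -, -, hx⟩ := key 1
    rw [zero_smul, smul_eq_zero] at hx
    have h0 := fA.1 ((hx.resolve_left (div_ne_zero hc₂ hc₃)).trans (map_zero HA).symm)
    exact one_ne_zero h0
  refine ⟨l * c₁ * c₃ / c₂, div_ne_zero (mul_ne_zero (mul_ne_zero hl0 hc₁) hc₃) hc₂, fun z => ?_⟩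
  obtain ⟨x, -, hxB, hx⟩ := key z
  have hz : HA z = (l * c₃ / c₂) • x := by
    have := congrArg (fun v => (c₃ / c₂) • v) hx
    simp only [smul_smul] at this
    rw [div_mul_div_cancel₀ hc₂, div_self hc₃, one_smul] at this
    rw [this]; congr 1; ring
  have := B.smul_mem (l * c₃ / c₂) (B.add_mem hxB (h₁ z))
  rw [sub_add_sub_cancel, smul_sub, smul_smul, ← hz] at this
  convert this using 3
  ring

/-- Frames aligned around a quadrilateral force scalar monodromy. -/
theorem scalarMonodromy_of_aligned {HA HB HC HE : (Fin 2 → F) →ₗ[F] (Fin 4 → F)}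
    (fA : FrameOn A HA) (fB : FrameMod B HB) (fC : FrameOn C HC) (fE : FrameMod E HE)
    (hAB : Aligned B HA HB) (hCB : Aligned B HC HB) (hCE : Aligned E HC HE)
    (hAE : Aligned E HA HE) : ScalarMonodromy A B C E := by
  obtain ⟨c₁, hc₁, h₁⟩ := hAB
  obtain ⟨c₂, hc₂, h₂⟩ := hCB
  obtain ⟨c₃, hc₃, h₃⟩ := hCE
  obtain ⟨c₄, hc₄, h₄⟩ := hAE
  refine ⟨c₃ / c₄ * (c₁ / c₂), fun x hx x' hx' y hy hxy hxy' => ?_⟩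
  obtain ⟨z, rfl⟩ := fA.2.symm ▸ hx
  obtain ⟨z', rfl⟩ := fC.2.symm ▸ hy
  obtain ⟨z'', rfl⟩ := fA.2.symm ▸ hx'
  have e₁ : c₁ • z - c₂ • z' = 0 := fB _ (by
    have := B.add_mem (B.sub_mem hxy (h₁ z)) (h₂ z')
    convert this using 1
    rw [map_sub, map_smul, map_smul]
    abel)
  have e₂ : c₄ • z'' - c₃ • z' = 0 := fE _ (by
    have := E.add_mem (E.sub_mem hxy' (h₄ z'')) (h₃ z')
    convert this using 1
    rw [map_sub, map_smul, map_smul]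
    abel)
  rw [← map_smul]
  congr 1
  have e₁ : z' = (c₁ / c₂) • z := by
    rw [div_eq_inv_mul, mul_smul, sub_eq_zero.1 e₁, inv_smul_smul₀ hc₂]
  rw [mul_smul, ← e₁, div_eq_inv_mul, mul_smul, ← sub_eq_zero.1 e₂, inv_smul_smul₀ hc₄]

end ProjectiveThreeSpace

/-! ### Spanning trees and sections on a quadrangulated sphere. -/

namespace SurfaceMap

variable {D : Type*} (T : SurfaceMap D)

theorem tail_next (d : D) : T.tail (T.next d) = T.head d := by
  have h : T.rot (T.next d) = T.rev d := by simp [rot]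
  refine Quotient.sound ?_
  change T.rot.SameCycle (T.next d) (T.rev d)
  rw [← h]
  exact Equiv.Perm.sameCycle_apply_right.2 (Equiv.Perm.SameCycle.refl _ _)

theorem head_rev (d : D) : T.head (T.rev d) = T.tail d := by
  rw [head, T.rev_rev]

theorem face_next (d : D) : T.face (T.next d) = T.face d :=
  Quotient.sound (Equiv.Perm.sameCycle_apply_left.2 (Equiv.Perm.SameCycle.refl _ _))

theorem IsConnected.eq_univ {T : SurfaceMap D} (hT : T.IsConnected) {S : Set D} {d₀ : D}
    (h₀ : d₀ ∈ S) (hrev : ∀ d, T.rev d ∈ S ↔ d ∈ S) (hnext : ∀ d, T.next d ∈ S ↔ d ∈ S)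
    (d : D) : d ∈ S := by
  obtain ⟨g, hg, rfl⟩ := hT d₀ d
  have key : ∀ e, g e ∈ S ↔ e ∈ S := by
    induction hg using Subgroup.closure_induction with
    | mem x hx =>
      rcases hx with rfl | rfl
      · exact hrev
      · exact hnext
    | one => simp
    | mul x y _ _ hx hy => intro e; rw [Equiv.Perm.mul_apply, hx, hy]
    | inv x _ hx => intro e; rw [← hx (x⁻¹ e)]; simp
  exact (key d₀).2 h₀

theorem sameCycle_rev_iff (d e : D) : T.rev.SameCycle d e ↔ e = d ∨ e = T.rev d := by
  constructor
  · rintro ⟨i, rfl⟩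
    have h2 : T.rev ^ 2 = 1 := by
      ext d; simp [sq, T.rev_rev]
    rcases Int.even_or_odd' i with ⟨k, rfl | rfl⟩
    · left; simp [zpow_mul, h2]
    · right; simp [zpow_add, zpow_mul, h2]
  · rintro (rfl | rfl)
    · exact Equiv.Perm.SameCycle.refl _ _
    · exact Equiv.Perm.sameCycle_apply_right.2 (Equiv.Perm.SameCycle.refl _ _)

theorem card_darts [Finite D] : Nat.card D = 2 * Nat.card T.Edge := by
  classical
  have := Fintype.ofFinite D
  have : Finite T.Edge := Quotient.finite _
  have := Fintype.ofFinite T.Edge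
  let m : D → T.Edge := Quotient.mk (Equiv.Perm.SameCycle.setoid T.rev)
  rw [Nat.card_eq_fintype_card, Nat.card_eq_fintype_card, ← Finset.card_univ,
    Finset.card_eq_sum_card_fiberwise (f := m) (t := Finset.univ) (by simp)]
  rw [Finset.sum_const_nat (m := 2), Finset.card_univ, mul_comm]
  intro e _
  induction e using Quotient.inductionOn with
  | h d =>
    have : Finset.univ.filter (fun x => m x = Quotient.mk _ d) = {d, T.rev d} := by
      ext x
      simp only [Finset.mem_filter, Finset.mem_univ, true_and, Finset.mem_insert,
        Finset.mem_singleton, ← T.sameCycle_rev_iff]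
      exact Quotient.eq.trans ⟨fun h => h.symm, fun h => h.symm⟩
    rw [this, Finset.card_pair (T.rev_ne d).symm]

/-- A set of darts closed under reversal that determines every closed predicate: the edges that
do not cross a spanning tree of the dual graph. -/
theorem exists_determining_darts [Finite D] (hT : T.IsConnected)
    (hq : T.FacesAreQuadrilaterals) (f₀ : T.Face) :
    ∃ K : Finset D, (∀ d ∈ K, T.rev d ∈ K) ∧ K.card + 2 * Nat.card T.Face = Nat.card D + 2 ∧
      ∀ Q : D → Prop, (∀ d, Q d → Q (T.rev d)) →
        (∀ d, T.face d ≠ f₀ → Q (T.next d) → Q (T.next (T.next d)) →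
          Q (T.next (T.next (T.next d))) → Q d) →
        (∀ d ∈ K, Q d) → ∀ d, Q d := by
  classical
  have := Fintype.ofFinite D
  have : Finite T.Face := Quotient.finite _
  have := Fintype.ofFinite T.Face
  -- `S` is the set of faces reached by a growing dual tree rooted at `f₀`, and `K` the darts not
  -- crossing it. Each new face costs one edge, that is, two darts.
  have key : ∀ n < Nat.card T.Face, ∃ (S : Finset T.Face) (K : Finset D), f₀ ∈ S ∧
      S.card = n + 1 ∧ (∀ d ∈ K, T.rev d ∈ K) ∧ (∀ d, T.face d ∉ S → d ∈ K) ∧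
      K.card + 2 * S.card = Nat.card D + 2 ∧
      ∀ Q : D → Prop, (∀ d, Q d → Q (T.rev d)) →
        (∀ d, T.face d ≠ f₀ → Q (T.next d) → Q (T.next (T.next d)) →
          Q (T.next (T.next (T.next d))) → Q d) →
        (∀ d ∈ K, Q d) → ∀ d, Q d := by
    intro n
    induction n with
    | zero =>
      intro _
      exact ⟨{f₀}, Finset.univ, by simp, by simp, by simp, by simp,
        by simp [Nat.card_eq_fintype_card], fun Q _ _ h d => h d (Finset.mem_univ d)⟩
    | succ n ih =>
      intro hn
      obtain ⟨S, K, hS₀, hS, hKrev, hKS, hK, hQ⟩ := ih (by omega)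
      obtain ⟨d, hd, hd'⟩ : ∃ d, T.face d ∈ S ∧ T.face (T.rev d) ∉ S := by
        by_contra! hcon
        obtain ⟨d₀, rfl⟩ : ∃ d, T.face d = f₀ := Quotient.exists_rep f₀
        have hall := hT.eq_univ (S := {d | T.face d ∈ S}) (d₀ := d₀) hS₀
          (fun d => ⟨fun h => by simpa [T.rev_rev] using hcon _ h, hcon d⟩)
          (fun d => by simp [face_next])
        have : S = Finset.univ := by
          ext f
          obtain ⟨d, rfl⟩ : ∃ d, T.face d = f := Quotient.exists_rep f
          simpa using hall d
        rw [this, Finset.card_univ, ← Nat.card_eq_fintype_card] at hS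
        omega
      have hdK' : T.rev d ∈ K := hKS _ hd'
      have hdK : d ∈ K := by simpa [T.rev_rev] using hKrev _ hdK'
      refine ⟨insert (T.face (T.rev d)) S, (K.erase d).erase (T.rev d), by simp [hS₀],
        by simp [hd', hS], ?_, ?_, ?_, ?_⟩
      · intro e he
        simp only [Finset.mem_erase, ne_eq] at he ⊢
        refine ⟨fun h => he.2.1 (T.rev.injective h), fun h => he.1 ?_, hKrev _ he.2.2⟩
        rw [← h, T.rev_rev]
      · intro e he
        simp only [Finset.mem_insert, not_or] at he
        simp only [Finset.mem_erase, ne_eq]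
        exact ⟨fun h => he.1 (h ▸ rfl), fun h => he.2 (h ▸ hd), hKS _ he.2⟩
      · have h1 := Finset.card_erase_add_one hdK
        have h2 := Finset.card_erase_add_one
          (Finset.mem_erase.2 ⟨T.rev_ne d, hdK'⟩)
        rw [Finset.card_insert_of_notMem hd']
        omega
      · intro Q hQrev hQf hQK
        refine hQ Q hQrev hQf ?_
        have hmem : ∀ e, T.face e = T.face (T.rev d) → e ≠ T.rev d → Q e := by
          intro e he hne
          refine hQK e ?_
          simp only [Finset.mem_erase, ne_eq]
          refine ⟨hne, fun h => hd' (he ▸ h ▸ hd), hKS _ (he ▸ hd')⟩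
        have hinj := (hq (T.rev d)).2
        -- The other three darts of the new face are still in `K`, so that face recovers the erased
        -- edge.
        have hrev : Q (T.rev d) := by
          refine hQf _ (fun h => hd' (h ▸ hS₀)) (hmem _ ?_ ?_) (hmem _ ?_ ?_) (hmem _ ?_ ?_)
          · simp [face_next]
          · intro h
            have := @hinj 1 0 (by simp [h])
            simp at this
          · simp [face_next]
          · intro h
            have := @hinj 2 0 (by simp [h])
            simp at this
          · simp [face_next]
          · intro h
            have := @hinj 3 0 (by simp [h])
            simp at this
        intro e he
        by_cases h1 : e = T.rev d
        · exact h1 ▸ hrev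
        by_cases h2 : e = d
        · have := hQrev _ hrev
          rw [T.rev_rev] at this
          exact h2 ▸ this
        exact hQK e (by simp [h1, h2, he])
  have hpos : 0 < Nat.card T.Face := Nat.card_pos_iff.2 ⟨⟨f₀⟩, inferInstance⟩
  obtain ⟨S, K, -, hS, hrev, -, hK, hQ⟩ := key (Nat.card T.Face - 1) (by omega)
  exact ⟨K, hrev, by rw [hS] at hK; omega, hQ⟩

/-- A local system on a quadrangulated sphere that is flat on all faces but one has a global
section. -/
theorem IsSphereQuadTiling.exists_section {T : SurfaceMap D} [Finite D]
    (hT : T.IsSphereQuadTiling) (f₀ : T.Face) {X : Type*} (P : T.Vertex → X → Prop)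
    (R : D → X → X → Prop) (hP : ∀ v, ∃ x, P v x)
    (hext : ∀ d x, P (T.tail d) x → ∃ y, P (T.head d) y ∧ R d x y)
    (hsymm : ∀ d x y, R d x y → R (T.rev d) y x)
    (hface : ∀ h : T.Vertex → X, (∀ v, P v (h v)) → ∀ d, T.face d ≠ f₀ →
      R (T.next d) (h (T.tail (T.next d))) (h (T.head (T.next d))) →
      R (T.next (T.next d)) (h (T.tail (T.next (T.next d)))) (h (T.head (T.next (T.next d)))) →
      R (T.next (T.next (T.next d))) (h (T.tail (T.next (T.next (T.next d)))))
        (h (T.head (T.next (T.next (T.next d))))) →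
      R d (h (T.tail d)) (h (T.head d))) :
    ∃ h : T.Vertex → X, (∀ v, P v (h v)) ∧ ∀ d, R d (h (T.tail d)) (h (T.head d)) := by
  classical
  have := Fintype.ofFinite D
  have : Finite T.Vertex := Quotient.finite _
  have := Fintype.ofFinite T.Vertex
  obtain ⟨⟨hconn, heuler⟩, hq, -⟩ := hT
  obtain ⟨K, hKrev, hK, hdet⟩ := T.exists_determining_darts hconn hq f₀
  obtain ⟨d₀, -⟩ : ∃ d, T.face d = f₀ := Quotient.exists_rep f₀
  -- The edges in `K` connect all vertices: having both ends on the same side of `W` passes from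
  -- three edges of a face to the fourth, so it would spread from `K` to every edge.
  have hleave : ∀ W : Finset T.Vertex, T.tail d₀ ∈ W → W ≠ Finset.univ →
      ∃ d ∈ K, T.tail d ∈ W ∧ T.head d ∉ W := by
    intro W hW hne
    by_contra! hcon
    refine hne ?_
    have hall := hdet (fun d => T.tail d ∈ W ↔ T.head d ∈ W)
      (fun d h => by rw [head_rev, h]; rfl)
      (fun d _ h1 h2 h3 => by
        rw [← tail_next, (hq d).1] at h3
        rw [← tail_next] at h1 h2
        rw [← T.tail_next d, h1, h2, h3])
      (fun d hd => ⟨hcon d hd, fun h => by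
        simpa [head_rev] using hcon _ (hKrev d hd) h⟩)
    have h2 := hconn.eq_univ (S := {d | T.tail d ∈ W}) (d₀ := d₀) hW
      (fun d => (hall d).symm) (fun d => by
        simp only [Set.mem_ofPred_eq, tail_next]
        exact (hall d).symm)
    ext v
    obtain ⟨d, rfl⟩ : ∃ d, T.tail d = v := Quotient.exists_rep v
    simpa using h2 d
  choose x₀ hx₀ using hP
  -- `K'` holds both darts of each edge of a tree on `W`; values of `h` are propagated to each new
  -- vertex.
  have key : ∀ n < Nat.card T.Vertex, ∃ (W : Finset T.Vertex) (K' : Finset D) (h : T.Vertex → X),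
      T.tail d₀ ∈ W ∧ W.card = n + 1 ∧ K'.card + 2 = 2 * W.card ∧ K' ⊆ K ∧
      (∀ v, P v (h v)) ∧ (∀ d ∈ K', T.tail d ∈ W) ∧ (∀ d ∈ K', T.head d ∈ W) ∧
      ∀ d ∈ K', R d (h (T.tail d)) (h (T.head d)) := by
    intro n
    induction n with
    | zero =>
      intro _
      exact ⟨{T.tail d₀}, ∅, x₀, by simp, by simp, by simp, by simp, hx₀, by simp⟩
    | succ n ih =>
      intro hn
      obtain ⟨W, K', h, hW₀, hW, hK', hsub, hP, htail, hhead, hR⟩ := ih (by omega)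
      obtain ⟨d, hdK, hd, hd'⟩ := hleave W hW₀ (by
        rintro rfl
        rw [Finset.card_univ, ← Nat.card_eq_fintype_card] at hW
        omega)
      obtain ⟨y, hy, hRy⟩ := hext d _ (hP (T.tail d))
      have hne : T.tail d ≠ T.head d := fun h => hd' (h ▸ hd)
      have h1 : d ∉ K' := fun h => hd' (hhead _ h)
      have h2 : T.rev d ∉ K' := fun h => hd' (htail _ h)
      have hold : ∀ v ∈ W, Function.update h (T.head d) y v = h v := fun v hv =>
        Function.update_of_ne (fun e : v = T.head d => hd' (e ▸ hv)) _ _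
      refine ⟨insert (T.head d) W, insert d (insert (T.rev d) K'),
        Function.update h (T.head d) y, by simp [hW₀], by simp [hd', hW], ?_, ?_, ?_, ?_, ?_, ?_⟩
      · rw [Finset.card_insert_of_notMem hd', Finset.card_insert_of_notMem,
          Finset.card_insert_of_notMem h2]
        · omega
        · simp [h1, (T.rev_ne d).symm]
      · intro e he
        simp only [Finset.mem_insert] at he
        rcases he with rfl | rfl | he
        exacts [hdK, hKrev _ hdK, hsub he]
      · intro v
        by_cases hv : v = T.head d
        · subst hv; simpa using hy
        · simpa [hv] using hP v
      · intro e he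
        simp only [Finset.mem_insert] at he
        rcases he with rfl | rfl | he
        · simp [hd]
        · simp [head]
        · simp [htail _ he]
      · intro e he
        simp only [Finset.mem_insert] at he
        rcases he with rfl | rfl | he
        · simp
        · simp [head_rev, hd]
        · simp [hhead _ he]
      · intro e he
        have hRd : R d (Function.update h (T.head d) y (T.tail d))
            (Function.update h (T.head d) y (T.head d)) := by
          rw [hold _ hd]; simpa using hRy
        simp only [Finset.mem_insert] at he
        rcases he with rfl | rfl | he
        · exact hRd
        · rw [head_rev]
          exact hsymm _ _ _ hRd
        · rw [hold _ (htail _ he), hold _ (hhead _ he)]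
          exact hR e he
  have hpos : 0 < Nat.card T.Vertex := Nat.card_pos_iff.2 ⟨⟨T.tail d₀⟩, inferInstance⟩
  obtain ⟨W, K', h, -, hW, hK', hsub, hP, -, -, hR⟩ := key (Nat.card T.Vertex - 1) (by omega)
  -- By Euler's formula `K` has `2|V| - 2` darts, so the spanning tree exhausts it.
  have hKK : K' = K := by
    refine Finset.eq_of_subset_of_card_le hsub ?_
    have := T.card_darts
    omega
  subst hKK
  exact ⟨h, hP, hdet (fun d => R d (h (T.tail d)) (h (T.head d)))
    (fun d hd => by rw [head_rev]; exact hsymm _ _ _ hd) (hface h hP) hR⟩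

end SurfaceMap

/-! ### The local system of frames and the theorem. -/

namespace ProjectiveThreeSpace

variable {F : Type*} [Field F] {D : Type*}

theorem image_faceVertices (T : SurfaceMap D) (hq : T.FacesAreQuadrilaterals)
    (L : T.Vertex → Submodule F (Fin 4 → F)) (d : D) :
    L '' T.faceVertices (T.face d) = {L (T.tail d), L (T.tail (T.next d)),
      L (T.tail (T.next (T.next d))), L (T.tail (T.next (T.next (T.next d))))} := by
  ext M
  simp only [Set.mem_insert_iff, Set.mem_singleton_iff, Set.mem_image]
  constructor
  · rintro ⟨_, ⟨e, he, rfl⟩, rfl⟩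
    have hset : T.next.SameCycle d e := (Quotient.exact he).symm
    suffices e = d ∨ e = T.next d ∨ e = T.next (T.next d) ∨ e = T.next (T.next (T.next d)) by
      rcases this with rfl | rfl | rfl | rfl <;> simp
    obtain ⟨i, rfl⟩ := hset
    have h4 : T.next ^ (4 : ℤ) = 1 := by
      ext d
      exact (hq d).1
    have hi : T.next ^ i = T.next ^ (i % 4) := by
      conv_lhs => rw [← Int.emod_add_mul_ediv i 4, zpow_add, zpow_mul, h4]
      simp
    rw [hi]
    have h1 := Int.emod_nonneg i (b := 4) (by norm_num)
    have h2 := Int.emod_lt_of_pos i (b := 4) (by norm_num)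
    generalize i % 4 = j at h1 h2
    interval_cases j
    · exact .inl rfl
    · exact .inr (.inl (by simp))
    · exact .inr (.inr (.inl rfl))
    · exact .inr (.inr (.inr rfl))
  · rintro (rfl | rfl | rfl | rfl)
    exacts [⟨_, ⟨d, rfl, rfl⟩, rfl⟩, ⟨_, ⟨T.next d, by simp [T.face_next], rfl⟩, rfl⟩,
      ⟨_, ⟨T.next (T.next d), by simp [T.face_next], rfl⟩, rfl⟩,
      ⟨_, ⟨T.next (T.next (T.next d)), by simp [T.face_next], rfl⟩, rfl⟩]

/-- If all faces but one carry lines of a single ruling, the remaining face has scalar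
monodromy. -/
theorem scalarMonodromy_of_tiling [Finite D] (T : SurfaceMap D) (hT : T.IsSphereQuadTiling)
    (L : T.Vertex → Submodule F (Fin 4 → F)) (hL : ∀ v, IsLine (L v))
    (hskew : ∀ d : D, Skew (L (T.tail d)) (L (T.head d))) (f₀ : T.Face)
    (hf : ∀ f : T.Face, f ≠ f₀ → LieInSingleRuling (L '' T.faceVertices f))
    (black : T.Vertex → Bool) (hblack : ∀ d : D, black (T.tail d) ≠ black (T.head d))
    (d : D) (hd : black (T.tail d) = true) :
    ScalarMonodromy (L (T.tail d)) (L (T.tail (T.next d))) (L (T.tail (T.next (T.next d))))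
      (L (T.tail (T.next (T.next (T.next d))))) := by
  have hskew' : ∀ d : D, Skew (L (T.head d)) (L (T.tail d)) := fun d => (hskew d).symm
  have hlast : ∀ d : D, T.head (T.next (T.next (T.next d))) = T.tail d := fun d => by
    rw [← T.tail_next, (hT.quad d).1]
  have hTF : ∀ d, black (T.tail d) = true → black (T.head d) = false := fun d h => by
    have := hblack d; simp_all
  have hFT : ∀ d, black (T.tail d) = false → black (T.head d) = true := fun d h => by
    have := hblack d; simp_all
  let P : T.Vertex → ((Fin 2 → F) →ₗ[F] (Fin 4 → F)) → Prop := fun v H =>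
    if black v = true then FrameOn (L v) H else FrameMod (L v) H
  have hPT : ∀ {v H}, black v = true → P v H → FrameOn (L v) H := fun h hP => by
    simpa [P, h] using hP
  have hPF : ∀ {v H}, black v = false → P v H → FrameMod (L v) H := fun h hP => by
    simpa [P, h] using hP
  let R : D → ((Fin 2 → F) →ₗ[F] (Fin 4 → F)) → ((Fin 2 → F) →ₗ[F] (Fin 4 → F)) → Prop :=
    fun d H G => if black (T.tail d) = true then Aligned (L (T.head d)) H G
      else Aligned (L (T.tail d)) G H
  have hRT : ∀ {d H G}, black (T.tail d) = true →
      (R d H G ↔ Aligned (L (T.head d)) H G) := fun h => by simp [R, h]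
  have hRF : ∀ {d H G}, black (T.tail d) = false →
      (R d H G ↔ Aligned (L (T.tail d)) G H) := fun h => by simp [R, h]
  obtain ⟨h, hP, hR⟩ : ∃ h : T.Vertex → ((Fin 2 → F) →ₗ[F] (Fin 4 → F)),
      (∀ v, P v (h v)) ∧ ∀ d, R d (h (T.tail d)) (h (T.head d)) := by
    refine hT.exists_section f₀ P R ?_ ?_ ?_ ?_
    · intro v
      obtain ⟨d, rfl⟩ : ∃ d, T.tail d = v := Quotient.exists_rep v
      by_cases hb : black (T.tail d) = true
      · obtain ⟨H, hH⟩ := (hL (T.tail d)).exists_frameOn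
        exact ⟨H, by simpa [P, hb] using hH⟩
      -- A frame of any line skew to `L (T.tail d)` also frames the quotient.
      · obtain ⟨H, hH⟩ := (hL (T.head d)).exists_frameOn
        exact ⟨H, by simpa [P, hb] using hH.frameMod (hskew' d)⟩
    · intro d H hH
      cases hb : black (T.tail d) with
      | true =>
        refine ⟨H, ?_, (hRT hb).2 ⟨1, one_ne_zero, by simp⟩⟩
        simpa [P, hTF d hb] using (hPT hb hH).frameMod (hskew d)
      | false =>
        obtain ⟨G, hG, hGH⟩ := (hPF hb hH).exists_frameOn (hL (T.head d)) (hL _) (hskew' d)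
        exact ⟨G, by simpa [P, hFT d hb] using hG, (hRF hb).2 hGH⟩
    · intro d H G hHG
      cases hb : black (T.tail d) with
      | true => exact (hRF (hTF d hb)).2 ((hRT hb).1 hHG)
      | false =>
        refine (hRT (hFT d hb)).2 ?_
        rw [T.head_rev]
        exact (hRF hb).1 hHG
    · intro h hP d hdf r1 r2 r3
      have hrul := hf _ hdf
      rw [image_faceVertices T hT.quad] at hrul
      have s0 := hskew d
      have s1 := hskew (T.next d)
      have s2 := hskew (T.next (T.next d))
      have s3 := hskew (T.next (T.next (T.next d)))
      rw [hlast] at s3 r3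
      rw [← T.tail_next] at s0 s1 s2 r1 r2 ⊢
      cases hb : black (T.tail d) with
      | true =>
        have b1 : black (T.tail (T.next d)) = false := by rw [T.tail_next]; exact hTF d hb
        have b2 : black (T.tail (T.next (T.next d))) = true := by
          rw [T.tail_next]; exact hFT _ b1
        have b3 : black (T.tail (T.next (T.next (T.next d)))) = false := by
          rw [T.tail_next]; exact hTF _ b2
        have r1 := (hRF b1).1 r1
        have r2 := (hRT b2).1 r2
        have r3 := (hRF b3).1 r3
        rw [← T.tail_next] at r2
        refine (hRT hb).2 ?_
        rw [← T.tail_next]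
        exact (hrul.scalarMonodromy (by simp) (by simp) (by simp) (by simp) s0 s1 s3).aligned
          (hL _) (hL _) s0 (hPT hb (hP _)) (hPT b2 (hP _)) r1 r2 r3
      | false =>
        have b1 : black (T.tail (T.next d)) = true := by rw [T.tail_next]; exact hFT d hb
        have b2 : black (T.tail (T.next (T.next d))) = false := by
          rw [T.tail_next]; exact hTF _ b1
        have b3 : black (T.tail (T.next (T.next (T.next d)))) = true := by
          rw [T.tail_next]; exact hFT _ b2
        have r1 := (hRT b1).1 r1
        have r2 := (hRF b2).1 r2
        have r3 := (hRT b3).1 r3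
        rw [← T.tail_next] at r1
        rw [hlast] at r3
        -- The black end is now the head of `d`, so the face is traversed backwards from there.
        refine (hRF hb).2 ?_
        exact (hrul.scalarMonodromy (by simp) (by simp) (by simp) (by simp) s0.symm s3.symm
          s1.symm).aligned (hL _) (hL _) s0.symm (hPT b1 (hP _)) (hPT b3 (hP _)) r3 r2 r1
  have b1 : black (T.tail (T.next d)) = false := by rw [T.tail_next]; exact hTF d hd
  have b2 : black (T.tail (T.next (T.next d))) = true := by rw [T.tail_next]; exact hFT _ b1
  have b3 : black (T.tail (T.next (T.next (T.next d)))) = false := by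
    rw [T.tail_next]; exact hTF _ b2
  have r0 := (hRT hd).1 (hR d)
  have r1 := (hRF b1).1 (hR _)
  have r2 := (hRT b2).1 (hR _)
  have r3 := (hRF b3).1 (hR _)
  rw [hlast] at r3
  rw [← T.tail_next] at r0 r1 r2
  exact scalarMonodromy_of_aligned (hPT hd (hP _)) (hPF b1 (hP _)) (hPT b2 (hP _))
    (hPF b3 (hP _)) r0 r1 r2 r3

end ProjectiveThreeSpace

theorem mainTheorem9 {F : Type*} [Field F] {D : Type*} [Finite D]
    (T : SurfaceMap D) (hT : T.IsSphereQuadTiling)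
    (L : T.Vertex → Submodule F (Fin 4 → F))
    (hL : ∀ v, ProjectiveThreeSpace.IsLine (L v))
    (hskew : ∀ d : D, ProjectiveThreeSpace.Skew (L (T.tail d)) (L (T.head d)))
    (f₀ : T.Face)
    (hf : ∀ f : T.Face, f ≠ f₀ →
      ProjectiveThreeSpace.LieInSingleRuling (L '' T.faceVertices f)) :
    ProjectiveThreeSpace.LieInSingleRuling (L '' T.faceVertices f₀) := by
  obtain ⟨d, rfl⟩ : ∃ d, T.face d = f₀ := Quotient.exists_rep f₀
  have hmono : ∀ e : D, ProjectiveThreeSpace.ScalarMonodromy (L (T.tail e))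
      (L (T.tail (T.next e))) (L (T.tail (T.next (T.next e))))
      (L (T.tail (T.next (T.next (T.next e))))) := by
    intro e
    obtain ⟨black, hblack⟩ := hT.bicolorable
    -- The colours are exchanged if necessary so that the tail of `e` becomes black.
    exact ProjectiveThreeSpace.scalarMonodromy_of_tiling T hT L hL hskew (T.face d) hf
      (fun v => black v == black (T.tail e))
      (fun d' => by
        have := hblack d'
        revert this
        cases black (T.tail d') <;> cases black (T.head d') <;> cases black (T.tail e) <;> simp)
      e (by simp)
  have s0 := hskew d
  have s1 := hskew (T.next d)
  have s2 := hskew (T.next (T.next d))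
  have s3 := hskew (T.next (T.next (T.next d)))
  have m1 := hmono (T.next d)
  rw [(hT.quad d).1] at m1
  rw [← T.tail_next] at s0 s1 s2 s3
  rw [(hT.quad d).1] at s3
  rw [ProjectiveThreeSpace.image_faceVertices T hT.quad]
  exact ProjectiveThreeSpace.lieInSingleRuling_of_scalarMonodromy (hL _) (hL _) (hL _) (hL _)
    s0 s1 s2 s3 (hmono d) m1
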